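/- Let $R$ be a commutative Noetherian ring with identity, let $I,J$ be ideals of $R$, and let $\mathcal S$ be a Serre class of $R$-modules, i.e. a class containing $0$ and closed under submodules, quotients and extensions. Put $W(I,J)=\{\mathfrak p\in\operatorname{Spec}R : I^m\subseteq \mathfrak p+J \text{ for some } m\ge 1\}$ and $\tilde W(I,J)=\{\mathfrak a \text{ an ideal of } R : I^m\subseteq \mathfrak a+J \text{ for some } m\ge 0\}$. For an $R$-module $X$ let $\Gamma_{I,J}(X)$ be the submodule of all $x\in X$ with $\operatorname{Supp}(Rx)\subseteq W(I,J)$, and let $H^i_{I,J}$ be the $i$-th right derived functor of $\Gamma_{I,J}$. Let $M$ be a ZD-module, i.e. an $R$-module such that for every submodule $N$ of $M$ the set $\{r\in R : rx=0 \text{ for some } 0\ne x\in M/N\}$ of zero divisors on $M/N$ is a union of finitely many primes belonging to $\operatorname{Ass}_R(M/N)$. Assume that $M$ has finite Krull dimension, i.e. that the lengths of chains of primes in $\operatorname{Supp}_R(M)$ are bounded. Let $n\ge 1$ be an integer such that $H^i_{I,J}(M)\in\mathcal S$ for all $i>n$. Then $$H^i_{I,J}(M)/\mathfrak a^{j}H^i_{I,J}(M)\in\mathcal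 S$$ for every $\mathfrak a\in\tilde W(I,J)$, every $i\ge n$ and every $j\ge 0$. -/

import Mathlib

universe u

namespace PairLC

open CategoryTheory

section

variable {R : Type u} [CommRing R]

/-- The set `W(I,J)` of primes `p` with `I ^ n ⊆ p + J` for some `n ≥ 1`. -/
def W (I J : Ideal R) : Set (PrimeSpectrum R) :=
  {p | ∃ n : ℕ, 1 ≤ n ∧ I ^ n ≤ p.asIdeal ⊔ J}

/-- The set `W̃(I,J)` of ideals `𝔞` with `I ^ n ⊆ 𝔞 + J` for some `n ≥ 0`. -/
def Wtilde (I J : Ideal R) : Set (Ideal R) :=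
  {𝔞 | ∃ n : ℕ, I ^ n ≤ 𝔞 ⊔ J}

section Module

variable {M N : Type u} [AddCommGroup M] [Module R M] [AddCommGroup N] [Module R N]

theorem mem_support_span_singleton (x : M) (p : PrimeSpectrum R) :
    p ∈ Module.support R (Submodule.span R {x}) ↔ ∀ r : R, r • x = 0 → r ∈ p.asIdeal := by
  rw [Module.support_eq_zeroLocus, PrimeSpectrum.mem_zeroLocus, SetLike.coe_subset_coe,
    SetLike.le_def]
  simp only [Submodule.mem_annihilator_span_singleton]

variable (M) in
/-- The `(I,J)`-torsion submodule `Γ_{I,J}(M)`: all `x` in `M` with `Supp(Rx) ⊆ W(I,J)`. -/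
def torsion (I J : Ideal R) : Submodule R M where
  carrier := {x | Module.support R (Submodule.span R {x}) ⊆ W I J}
  zero_mem' := by
    intro p hp
    rw [mem_support_span_singleton] at hp
    exact absurd ((Ideal.eq_top_iff_one _).2 (hp 1 (smul_zero 1))) p.isPrime.ne_top
  add_mem' := by
    intro x y hx hy p hp
    rw [mem_support_span_singleton] at hp
    by_contra hW
    have h1 : ¬ ∀ r : R, r • x = 0 → r ∈ p.asIdeal :=
      fun h => hW (hx ((mem_support_span_singleton x p).2 h))
    have h2 : ¬ ∀ r : R, r • y = 0 → r ∈ p.asIdeal :=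
      fun h => hW (hy ((mem_support_span_singleton y p).2 h))
    push Not at h1 h2
    obtain ⟨r, hr, hrp⟩ := h1
    obtain ⟨s, hs, hsp⟩ := h2
    refine (p.isPrime.mem_or_mem (hp (r * s) ?_)).elim hrp hsp
    rw [smul_add, mul_smul r s y, hs, mul_comm, mul_smul, hr, smul_zero, smul_zero, add_zero]
  smul_mem' := by
    intro c x hx p hp
    rw [mem_support_span_singleton] at hp
    refine hx ((mem_support_span_singleton x p).2 fun r hr => hp r ?_)
    rw [smul_comm, hr, smul_zero]

theorem map_mem_torsion (I J : Ideal R) (f : M →ₗ[R] N) :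
    ∀ x ∈ torsion M I J, f x ∈ torsion N I J := by
  intro x hx p hp
  rw [mem_support_span_singleton] at hp
  refine hx ((mem_support_span_singleton x p).2 fun r hr => hp r ?_)
  rw [← map_smul, hr, map_zero]

end Module

/-- The `(I,J)`-torsion functor `Γ_{I,J}`. -/
def torsionFunctor (I J : Ideal R) : ModuleCat.{u} R ⥤ ModuleCat.{u} R where
  obj M := ModuleCat.of R (torsion M I J)
  map f := ModuleCat.ofHom (f.hom.restrict (map_mem_torsion I J f.hom))
  map_id _ := rfl
  map_comp _ _ := rfl

instance (I J : Ideal R) : (torsionFunctor I J).Additive where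
  map_add := rfl

/-- `H^i_{I,J}`, the `i`-th right derived functor of `Γ_{I,J}`. -/
noncomputable def lc (I J : Ideal R) (i : ℕ) : ModuleCat.{u} R ⥤ ModuleCat.{u} R :=
  (torsionFunctor I J).rightDerived i

/-- The set of zero divisors of `R` on the module `M`. -/
def zeroDivisors (R : Type u) [CommRing R] (M : Type u) [AddCommGroup M] [Module R M] : Set R :=
  {r | ∃ m : M, m ≠ 0 ∧ r • m = 0}

/-- `M` is a ZD-module: for every submodule `N`, the set of zero divisors on `M/N` is a union of
finitely many prime ideals belonging to `Ass(M/N)`. -/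
def IsZD (R : Type u) [CommRing R] (M : Type u) [AddCommGroup M] [Module R M] : Prop :=
  ∀ N : Submodule R M, ∃ F : Set (Ideal R), F.Finite ∧ F ⊆ associatedPrimes R (M ⧸ N) ∧
    zeroDivisors R (M ⧸ N) = ⋃ p ∈ F, (p : Set R)

end

end PairLC

/-! For `i > n` the claim is closure of `S` under quotients, so the content is the case `i = n`; and
since `Wtilde I J` is closed under powers, `j = 1` suffices. The proof is an induction on the
dimension of the support.

Replacing `M` by `M' = M/Γ(M)` changes no cohomology in positive degrees, because torsion modules
are acyclic (`isZero_lc_succ_of_torsion_eq_top`). This in turn rests on `Γ` preserving injectives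
(`injective_torsion`). On the torsion-free ZD-module `M'`, prime avoidance yields a nonzerodivisor
`r ∈ 𝔞`. The quotient `M'' = M'/rM'` is again ZD, has smaller dimension, and inherits the hypothesis
on cohomology above `n`. In the exact sequence `Hⁿ(M') --r--> Hⁿ(M') → Hⁿ(M'') → Hⁿ⁺¹(M')` the
middle map has kernel `rHⁿ(M') ⊆ 𝔞Hⁿ(M')` and a cokernel that embeds in a member of `S`, while
`Hⁿ(M'')/𝔞Hⁿ(M'')` is in `S` by induction. `serre_quotient_smul_top` converts exactly these three
facts into the conclusion. -/

namespace PairLC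

open CategoryTheory Limits

/-! ### Horseshoe lemma and the long exact sequence of right derived functors -/

section Horseshoe

variable {C : Type*} [Category* C] [Abelian C] {X Z : C}

/-- The augmentation `X ⟶ P⁰` of an injective resolution. -/
def aug (P : InjectiveResolution X) : X ⟶ P.cocomplex.X 0 := P.ι.f 0

instance (P : InjectiveResolution X) : Mono (aug P) :=
  inferInstanceAs (Mono (P.ι.f 0))

@[simp]
theorem aug_d (P : InjectiveResolution X) : aug P ≫ P.cocomplex.d 0 1 = 0 :=
  P.ι_f_zero_comp_complex_d

@[simp]
theorem aug_d_assoc (P : InjectiveResolution X) {T : C} (h : P.cocomplex.X 1 ⟶ T) :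
    aug P ≫ P.cocomplex.d 0 1 ≫ h = 0 := by
  rw [← Category.assoc, aug_d, zero_comp]

theorem exact_aug_d (P : InjectiveResolution X) :
    (ShortComplex.mk (aug P) (P.cocomplex.d 0 1) (aug_d P)).Exact :=
  P.exact₀

variable (P : InjectiveResolution X) (Q : InjectiveResolution Z)

/-- A morphism `Qⁿ ⟶ Pⁿ⁺¹` that maps cocycles to cocycles. -/
def PreservesCocycles (n : ℕ) (t : Q.cocomplex.X n ⟶ P.cocomplex.X (n + 1)) : Prop :=
  ∀ ⦃T : C⦄ (h : T ⟶ Q.cocomplex.X n), h ≫ Q.cocomplex.d n (n + 1) = 0 →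
    h ≫ t ≫ P.cocomplex.d (n + 1) (n + 2) = 0

variable {P Q} in
theorem PreservesCocycles.exists_succ {n : ℕ} {t : Q.cocomplex.X n ⟶ P.cocomplex.X (n + 1)}
    (ht : PreservesCocycles P Q n t) :
    ∃ t' : Q.cocomplex.X (n + 1) ⟶ P.cocomplex.X (n + 2), PreservesCocycles P Q (n + 1) t' ∧
      Q.cocomplex.d n (n + 1) ≫ t' = -(t ≫ P.cocomplex.d (n + 1) (n + 2)) := by
  have hex : (ShortComplex.mk (kernel.ι (Q.cocomplex.d n (n + 1))) (Q.cocomplex.d n (n + 1))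
      (kernel.condition _)).Exact := ShortComplex.exact_kernel _
  have h0 : kernel.ι (Q.cocomplex.d n (n + 1)) ≫
      (-(t ≫ P.cocomplex.d (n + 1) (n + 2))) = 0 := by
    rw [Preadditive.comp_neg, ht _ (kernel.condition _), neg_zero]
  have h1 := hex.comp_descToInjective _ h0
  refine ⟨hex.descToInjective _ h0, fun T h hh => ?_, h1⟩
  have h2 : Q.cocomplex.d n (n + 1) ≫
      (hex.descToInjective _ h0 ≫ P.cocomplex.d (n + 2) (n + 3)) = 0 := by
    dsimp at h1
    rw [← Category.assoc, h1]
    simp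
  have h3 := (Q.exact_succ n).comp_descToInjective _ h2
  dsimp at h3
  rw [← h3, reassoc_of% hh, zero_comp]

/-- The `τ n` become the off-diagonal entries of the differential on `P ⊞ Q`. Each is extended from
the previous one by injectivity of the terms of `P`; preservation of cocycles is the invariant that
keeps the extension possible. -/
theorem exists_twist (σ : Z ⟶ P.cocomplex.X 1) (hσ : σ ≫ P.cocomplex.d 1 2 = 0) :
    ∃ τ : ∀ n, Q.cocomplex.X n ⟶ P.cocomplex.X (n + 1),
      aug Q ≫ τ 0 = -σ ∧
      ∀ n, Q.cocomplex.d n (n + 1) ≫ τ (n + 1) =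
        -(τ n ≫ P.cocomplex.d (n + 1) (n + 2)) := by
  let t₀ : Q.cocomplex.X 0 ⟶ P.cocomplex.X 1 := Injective.factorThru (-σ) (aug Q)
  have ht₀ : aug Q ≫ t₀ = -σ := Injective.comp_factorThru (-σ) (aug Q)
  have hp₀ : PreservesCocycles P Q 0 t₀ := by
    intro T h hh
    have h2 : aug Q ≫ (t₀ ≫ P.cocomplex.d 1 2) = 0 := by
      rw [← Category.assoc, ht₀, Preadditive.neg_comp, hσ, neg_zero]
    have h3 := (exact_aug_d Q).comp_descToInjective _ h2
    dsimp at h3 ⊢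
    rw [← h3, reassoc_of% hh, zero_comp]
  let s : ∀ n, {t // PreservesCocycles P Q n t} := fun n =>
    Nat.rec ⟨t₀, hp₀⟩ (fun _ t => ⟨t.2.exists_succ.choose, t.2.exists_succ.choose_spec.1⟩) n
  exact ⟨fun n => (s n).1, ht₀, fun n => (s n).2.exists_succ.choose_spec.2⟩

theorem exists_twistedComplex (τ : ∀ n, Q.cocomplex.X n ⟶ P.cocomplex.X (n + 1))
    (hτ : ∀ n, Q.cocomplex.d n (n + 1) ≫ τ (n + 1) =
      -(τ n ≫ P.cocomplex.d (n + 1) (n + 2))) :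
    ∃ (B : CochainComplex C ℕ) (f : P.cocomplex ⟶ B) (g : B ⟶ Q.cocomplex)
      (r : ∀ n, B.X n ⟶ P.cocomplex.X n) (s : ∀ n, Q.cocomplex.X n ⟶ B.X n),
      (∀ n, Injective (B.X n)) ∧ (∀ n, f.f n ≫ g.f n = 0) ∧ (∀ n, f.f n ≫ r n = 𝟙 _) ∧
      (∀ n, s n ≫ g.f n = 𝟙 _) ∧ (∀ n, r n ≫ f.f n + g.f n ≫ s n = 𝟙 _) ∧
      ∀ n, s n ≫ B.d n (n + 1) = τ n ≫ f.f (n + 1) + Q.cocomplex.d n (n + 1) ≫ s (n + 1) := by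
  let D (n : ℕ) : (P.cocomplex.X n ⊞ Q.cocomplex.X n) ⟶
      (P.cocomplex.X (n + 1) ⊞ Q.cocomplex.X (n + 1)) :=
    biprod.desc (P.cocomplex.d n (n + 1) ≫ biprod.inl)
      (biprod.lift (τ n) (Q.cocomplex.d n (n + 1)))
  -- The differential is triangular, and its square vanishes because of the anticommutation `hτ`.
  have hD (n : ℕ) : D n ≫ D (n + 1) = 0 := by
    apply biprod.hom_ext' <;> apply biprod.hom_ext
    · simp [D]
    · simp [D]
    · have := hτ n
      simp only [D, biprod.inr_desc_assoc, biprod.lift_desc, Category.assoc, comp_zero, zero_comp,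
        Preadditive.add_comp, biprod.inl_fst, biprod.lift_fst, this, Category.comp_id]
      exact add_neg_cancel _
    · simp [D]
  let B : CochainComplex C ℕ :=
    CochainComplex.of (fun n => P.cocomplex.X n ⊞ Q.cocomplex.X n) D hD
  have hB (n : ℕ) : B.d n (n + 1) = D n := by
    simp [B]
  refine ⟨B, ⟨fun n => (biprod.inl : _ ⟶ P.cocomplex.X n ⊞ Q.cocomplex.X n), ?_⟩,
    ⟨fun n => (biprod.snd : P.cocomplex.X n ⊞ Q.cocomplex.X n ⟶ _), ?_⟩,
    fun n => (biprod.fst : P.cocomplex.X n ⊞ Q.cocomplex.X n ⟶ _),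
    fun n => (biprod.inr : _ ⟶ P.cocomplex.X n ⊞ Q.cocomplex.X n), fun n => ?_,
    fun n => biprod.inl_snd, fun n => biprod.inl_fst, fun n => biprod.inr_snd,
    fun n => biprod.total, fun n => ?_⟩
  · rintro i j rfl
    refine (congrArg (fun d => (biprod.inl : _ ⟶ P.cocomplex.X i ⊞ Q.cocomplex.X i) ≫ d)
      (hB i)).trans ?_
    simp [D]
  · rintro i j rfl
    refine Eq.trans ?_ (congrArg (fun d => d ≫
      (biprod.snd : P.cocomplex.X (i + 1) ⊞ Q.cocomplex.X (i + 1) ⟶ _)) (hB i)).symm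
    apply biprod.hom_ext' <;> simp [D]
  · exact inferInstanceAs (Injective (P.cocomplex.X n ⊞ Q.cocomplex.X n))
  · refine (congrArg (fun d => (biprod.inr : _ ⟶ P.cocomplex.X n ⊞ Q.cocomplex.X n) ≫ d)
      (hB n)).trans ?_
    apply biprod.hom_ext <;> simp [D]

theorem shortExact_of_splitting {S : ShortComplex (CochainComplex C ℕ)}
    (h : ∀ n, (S.map (HomologicalComplex.eval C (ComplexShape.up ℕ) n)).Splitting) :
    S.ShortExact :=
  HomologicalComplex.shortExact_of_degreewise_shortExact S fun n => (h n).shortExact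

/-- The injective resolution given by an exact coaugmented complex of injective objects. -/
noncomputable def resolutionOfExact (B : CochainComplex C ℕ) (hinj : ∀ n, Injective (B.X n))
    (β : X ⟶ B.X 0) [hβ : Mono β] (hβd : β ≫ B.d 0 1 = 0)
    (hex : (ShortComplex.mk β (B.d 0 1) hβd).Exact) (hB : ∀ n, B.ExactAt (n + 1)) :
    InjectiveResolution X where
  cocomplex := B
  injective := hinj
  ι := (CochainComplex.fromSingle₀Equiv _ _).symm ⟨β, hβd⟩
  quasiIso := ⟨fun n => by
    cases n
    · rw [CochainComplex.quasiIsoAt₀_iff, ShortComplex.quasiIso_iff_of_zeros]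
      · refine (ShortComplex.exact_and_mono_f_iff_of_iso ?_).2 ⟨hex, hβ⟩
        refine ShortComplex.isoMk (Iso.refl _) (Iso.refl _) (Iso.refl _) ?_ ?_
        · refine (Category.id_comp β).trans (Eq.trans ?_ (Category.comp_id _).symm)
          exact (CochainComplex.fromSingle₀Equiv_symm_apply_f_zero β hβd).symm
        · exact (Category.id_comp (B.d 0 1)).trans (Category.comp_id (B.d 0 1)).symm
      · rfl
      · rfl
      · exact B.shape _ _ (by simp)
    · rw [quasiIsoAt_iff_exactAt]
      · apply hB
      · apply CochainComplex.exactAt_succ_single_obj⟩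

theorem aug_resolutionOfExact (B : CochainComplex C ℕ) (hinj : ∀ n, Injective (B.X n))
    (β : X ⟶ B.X 0) [Mono β] (hβd : β ≫ B.d 0 1 = 0)
    (hex : (ShortComplex.mk β (B.d 0 1) hβd).Exact) (hB : ∀ n, B.ExactAt (n + 1)) :
    aug (resolutionOfExact B hinj β hβd hex hB) = β :=
  CochainComplex.fromSingle₀Equiv_symm_apply_f_zero β hβd

/-- The **horseshoe lemma**. -/
theorem exists_horseshoe {S : ShortComplex C} (hS : S.ShortExact)
    (P : InjectiveResolution S.X₁) (Q : InjectiveResolution S.X₃) :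
    ∃ (B : InjectiveResolution S.X₂) (f : P.cocomplex ⟶ B.cocomplex)
      (g : B.cocomplex ⟶ Q.cocomplex) (w : f ≫ g = 0),
      aug P ≫ f.f 0 = S.f ≫ aug B ∧ aug B ≫ g.f 0 = S.g ≫ aug Q ∧
      ∀ n, Nonempty (((ShortComplex.mk f g w).map
        (HomologicalComplex.eval C (ComplexShape.up ℕ) n)).Splitting) := by
  have : Mono S.f := hS.mono_f
  have : Epi S.g := hS.epi_g
  -- `ξ` need not land in cocycles; its coboundary factors through `S.g` as `σ`, the class that the
  -- twist has to cancel.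
  let ξ : S.X₂ ⟶ P.cocomplex.X 0 := Injective.factorThru (aug P) S.f
  have hξ : S.f ≫ ξ = aug P := Injective.comp_factorThru _ _
  have h0 : S.f ≫ (ξ ≫ P.cocomplex.d 0 1) = 0 := by
    rw [← Category.assoc, hξ, aug_d]
  let σ : S.X₃ ⟶ P.cocomplex.X 1 := hS.exact.desc _ h0
  have hσ : S.g ≫ σ = ξ ≫ P.cocomplex.d 0 1 := hS.exact.g_desc _ h0
  have hσd : σ ≫ P.cocomplex.d 1 2 = 0 := by
    rw [← cancel_epi S.g, ← Category.assoc, hσ]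
    simp
  obtain ⟨τ, hτ0, hτ⟩ := exists_twist P Q σ hσd
  obtain ⟨B, f, g, r, s, hinj, hfg, hfr, hsg, hrs, hsd⟩ := exists_twistedComplex P Q τ hτ
  have w : f ≫ g = 0 := by
    ext n
    exact hfg n
  let split (n : ℕ) : ((ShortComplex.mk f g w).map
      (HomologicalComplex.eval C (ComplexShape.up ℕ) n)).Splitting :=
    { r := r n, s := s n, f_r := hfr n, s_g := hsg n, id := hrs n }
  let β : S.X₂ ⟶ B.X 0 := ξ ≫ f.f 0 + (S.g ≫ aug Q) ≫ s 0
  have hβd : β ≫ B.d 0 1 = 0 := by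
    have h1 : s 0 ≫ B.d 0 1 = τ 0 ≫ f.f 1 + Q.cocomplex.d 0 1 ≫ s 1 := hsd 0
    have h2 := f.comm 0 1
    simp only [β, Preadditive.add_comp, Category.assoc, h1, h2, Preadditive.comp_add,
      aug_d_assoc, add_zero]
    rw [reassoc_of% hτ0, Preadditive.neg_comp, Preadditive.comp_neg, reassoc_of% hσ,
      add_neg_cancel]
  have hfβ : S.f ≫ β = aug P ≫ f.f 0 := by
    simp only [β, Preadditive.comp_add, reassoc_of% hξ, Category.assoc, S.zero_assoc, zero_comp,
      add_zero]
  have hβg : β ≫ g.f 0 = S.g ≫ aug Q := by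
    simp only [β, Preadditive.add_comp, Category.assoc, hfg, hsg, comp_zero, zero_add,
      Category.comp_id]
  have hβ : Mono β := by
    refine Preadditive.mono_of_cancel_zero _ fun {T} h hh => ?_
    have h1 : h ≫ S.g = 0 := by
      rw [← cancel_mono (aug Q), Category.assoc, ← hβg, reassoc_of% hh, zero_comp, zero_comp]
    obtain ⟨a, rfl⟩ : ∃ a : T ⟶ S.X₁, a ≫ S.f = h :=
      ⟨hS.exact.lift h h1, hS.exact.lift_f h h1⟩
    rw [Category.assoc, hfβ] at hh
    have : a ≫ aug P = 0 := by simpa [hfr] using congrArg (· ≫ r 0) hh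
    rw [zero_of_comp_mono _ this, zero_comp]
  have hex : (ShortComplex.mk β (B.d 0 1) hβd).Exact := by
    rw [ShortComplex.exact_iff_exact_up_to_refinements]
    intro T x hx
    dsimp at x hx
    have h1 : (x ≫ g.f 0) ≫ Q.cocomplex.d 0 1 = 0 := by
      rw [Category.assoc, g.comm, reassoc_of% hx, zero_comp]
    let c : T ⟶ S.X₃ := (exact_aug_d Q).lift _ h1
    have hc : c ≫ aug Q = x ≫ g.f 0 := (exact_aug_d Q).lift_f _ h1
    -- After refinement, subtracting `b ≫ β` removes the `Q`-component of the cocycle, leaving a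
    -- cocycle of `P`.
    obtain ⟨T', π, hπ, b, hb⟩ := surjective_up_to_refinements_of_epi S.g c
    let y : T' ⟶ P.cocomplex.X 0 := (π ≫ x - b ≫ β) ≫ r 0
    have hy : y ≫ f.f 0 = π ≫ x - b ≫ β := by
      have h2 : (π ≫ x - b ≫ β) ≫ g.f 0 = 0 := by
        rw [Preadditive.sub_comp, Category.assoc, Category.assoc, hβg, ← hc, reassoc_of% hb]
        exact sub_self _
      have h3 := congrArg ((π ≫ x - b ≫ β) ≫ ·) (hrs 0)
      simpa [reassoc_of% h2, y] using h3
    have hyd : y ≫ P.cocomplex.d 0 1 = 0 := by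
      have h4 : (y ≫ P.cocomplex.d 0 1) ≫ f.f 1 = 0 := by
        rw [Category.assoc, ← f.comm, reassoc_of% hy]
        simp [hx, hβd]
      simpa [hfr] using congrArg (· ≫ r 1) h4
    let a : T' ⟶ S.X₁ := (exact_aug_d P).lift _ hyd
    have ha : a ≫ aug P = y := (exact_aug_d P).lift_f _ hyd
    refine ⟨T', π, hπ, b + a ≫ S.f, ?_⟩
    dsimp
    rw [Preadditive.add_comp, Category.assoc, hfβ, reassoc_of% ha, hy]
    abel
  have hBex (n : ℕ) : B.ExactAt (n + 1) :=
    (shortExact_of_splitting split).exactAt_X₂ (n + 1) (P.cocomplex_exactAt_succ n)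
      (Q.cocomplex_exactAt_succ n)
  refine ⟨resolutionOfExact B hinj β hβd hex hBex, f, g, w, ?_, ?_, fun n => ⟨split n⟩⟩
  · rw [aug_resolutionOfExact]
    exact hfβ.symm
  · rw [aug_resolutionOfExact]
    exact hβg

/-- The long exact sequence of the right derived functors of an additive functor. -/
theorem exists_rightDerived_connecting {D : Type*} [Category* D] [Abelian D]
    [HasInjectiveResolutions C] (F : C ⥤ D) [F.Additive] {S : ShortComplex C} (hS : S.ShortExact)
    (n : ℕ) :
    ∃ (δ : (F.rightDerived n).obj S.X₃ ⟶ (F.rightDerived (n + 1)).obj S.X₁)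
      (w₀ : (F.rightDerived n).map S.f ≫ (F.rightDerived n).map S.g = 0)
      (w₁ : (F.rightDerived n).map S.g ≫ δ = 0) (w₂ : δ ≫ (F.rightDerived (n + 1)).map S.f = 0),
      (ShortComplex.mk _ _ w₀).Exact ∧ (ShortComplex.mk _ _ w₁).Exact ∧
      (ShortComplex.mk _ _ w₂).Exact := by
  obtain ⟨B, f, g, w, hf, hg, hsplit⟩ :=
    exists_horseshoe hS (injectiveResolution S.X₁) (injectiveResolution S.X₃)
  let P := injectiveResolution S.X₁
  let Q := injectiveResolution S.X₃
  let T : ShortComplex (CochainComplex D ℕ) :=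
    (ShortComplex.mk f g w).map (F.mapHomologicalComplex (ComplexShape.up ℕ))
  have hT : T.ShortExact := shortExact_of_splitting fun n => (hsplit n).some.map F
  have hf' (n : ℕ) := P.isoRightDerivedObj_hom_naturality S.f B f hf F n
  have hg' (n : ℕ) := B.isoRightDerivedObj_hom_naturality S.g Q g hg F n
  have hrel : (ComplexShape.up ℕ).Rel n (n + 1) := rfl
  let eP (n : ℕ) : (F.rightDerived n).obj S.X₁ ≅ T.X₁.homology n := P.isoRightDerivedObj F n
  let eB (n : ℕ) : (F.rightDerived n).obj S.X₂ ≅ T.X₂.homology n := B.isoRightDerivedObj F n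
  let eQ (n : ℕ) : (F.rightDerived n).obj S.X₃ ≅ T.X₃.homology n := Q.isoRightDerivedObj F n
  have hf'' (n : ℕ) : (F.rightDerived n).map S.f ≫ (eB n).hom =
      (eP n).hom ≫ HomologicalComplex.homologyMap T.f n := hf' n
  have hg'' (n : ℕ) : (F.rightDerived n).map S.g ≫ (eQ n).hom =
      (eB n).hom ≫ HomologicalComplex.homologyMap T.g n := hg' n
  let δ : (F.rightDerived n).obj S.X₃ ⟶ (F.rightDerived (n + 1)).obj S.X₁ :=
    (eQ n).hom ≫ hT.δ n (n + 1) hrel ≫ (eP (n + 1)).inv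
  have hδ : δ ≫ (eP (n + 1)).hom = (eQ n).hom ≫ hT.δ n (n + 1) hrel := by simp [δ]
  have w₀ : (F.rightDerived n).map S.f ≫ (F.rightDerived n).map S.g = 0 := by
    rw [← cancel_mono (eQ n).hom, Category.assoc, hg'', reassoc_of% hf'' n,
      ← HomologicalComplex.homologyMap_comp, T.zero, HomologicalComplex.homologyMap_zero]
    simp
  have w₁ : (F.rightDerived n).map S.g ≫ δ = 0 := by
    rw [← cancel_mono (eP (n + 1)).hom, Category.assoc, hδ, reassoc_of% hg'' n, hT.comp_δ]
    simp
  have w₂ : δ ≫ (F.rightDerived (n + 1)).map S.f = 0 := by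
    rw [← cancel_mono (eB (n + 1)).hom, Category.assoc, hf'', reassoc_of% hδ, hT.δ_comp]
    simp
  refine ⟨δ, w₀, w₁, w₂, ?_, ?_, ?_⟩
  · exact ShortComplex.exact_of_iso (ShortComplex.isoMk (eP n) (eB n) (eQ n)
      (hf'' n).symm (hg'' n).symm).symm (hT.homology_exact₂ n)
  · exact ShortComplex.exact_of_iso (ShortComplex.isoMk (eB n) (eQ n) (eP (n + 1))
      (hg'' n).symm hδ.symm).symm (hT.homology_exact₃ n (n + 1) hrel)
  · exact ShortComplex.exact_of_iso (ShortComplex.isoMk (eQ n) (eP (n + 1)) (eB (n + 1))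
      hδ.symm (hf'' (n + 1)).symm).symm (hT.homology_exact₁ n (n + 1) hrel)

/-- The right derived functors of a linear functor are linear. -/
theorem rightDerived_map_smul_id {k : Type*} [Ring k] {D : Type*} [Category* D] [Abelian D]
    [Linear k C] [Linear k D] [HasInjectiveResolutions C] (F : C ⥤ D) [F.Additive] [F.Linear k]
    (n : ℕ) (r : k) (Y : C) :
    (F.rightDerived n).map (r • 𝟙 Y) = r • 𝟙 ((F.rightDerived n).obj Y) := by
  let P := injectiveResolution Y
  have h := P.isoRightDerivedObj_hom_naturality (r • 𝟙 Y) P (r • 𝟙 P.cocomplex) (by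
      change aug P ≫ (r • 𝟙 (P.cocomplex.X 0)) = (r • 𝟙 Y) ≫ aug P
      simp) F n
  rw [← cancel_mono (P.isoRightDerivedObj F n).hom, h]
  have h1 : (F.mapHomologicalComplex (ComplexShape.up ℕ)).map (r • 𝟙 P.cocomplex) =
      r • 𝟙 ((F.mapHomologicalComplex (ComplexShape.up ℕ)).obj P.cocomplex) := by
    ext i
    simp
  have h2 : HomologicalComplex.homologyMap
      (r • 𝟙 ((F.mapHomologicalComplex (ComplexShape.up ℕ)).obj P.cocomplex)) n =
      r • 𝟙 _ := by
    have := ShortComplex.homologyMap_smul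
      (𝟙 (((F.mapHomologicalComplex (ComplexShape.up ℕ)).obj P.cocomplex).sc n)) r
    rw [ShortComplex.homologyMap_id] at this
    exact this
  simp only [Functor.comp_map, h1, HomologicalComplex.homologyFunctor_map, h2,
    Linear.smul_comp, Category.id_comp]
  exact (Linear.comp_smul _ _ _ _ _ _).trans (congrArg (r • ·) (Category.comp_id _))

end Horseshoe
-- The torsion submodule and its behaviour on injectives
section Torsion

variable {R : Type u} [CommRing R]

theorem mem_W_of_le {I J : Ideal R} {p q : PrimeSpectrum R} (hp : p ∈ W I J)
    (h : p.asIdeal ≤ q.asIdeal) : q ∈ W I J := by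
  obtain ⟨n, hn, hI⟩ := hp
  exact ⟨n, hn, hI.trans (sup_le_sup_right h J)⟩

theorem mem_W_of_mem_Wtilde {I J 𝔞 : Ideal R} (h𝔞 : 𝔞 ∈ Wtilde I J) {p : PrimeSpectrum R}
    (h : 𝔞 ≤ p.asIdeal) : p ∈ W I J := by
  obtain ⟨n, hI⟩ := h𝔞
  -- `Wtilde` allows the exponent `0` while `W` does not, hence the shift.
  exact ⟨n + 1, Nat.le_add_left 1 n,
    (Ideal.pow_le_pow_right (Nat.le_succ n)).trans (hI.trans (sup_le_sup_right h J))⟩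

theorem pow_mem_Wtilde {I J 𝔞 : Ideal R} (h𝔞 : 𝔞 ∈ Wtilde I J) (j : ℕ) :
    𝔞 ^ j ∈ Wtilde I J := by
  obtain ⟨n, hI⟩ := h𝔞
  -- This exponent works because `(𝔞 + J)ʲ ⊆ 𝔞ʲ + J`.
  refine ⟨n * j, ?_⟩
  rw [pow_mul]
  refine (Ideal.pow_right_mono hI j).trans ?_
  induction j with
  | zero => simp
  | succ j ih =>
    have h1 : (𝔞 ⊔ J) ^ (j + 1) ≤ (𝔞 ^ j ⊔ J) * (𝔞 ⊔ J) :=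
      (pow_succ (𝔞 ⊔ J) j).le.trans (Ideal.mul_mono_left ih)
    refine h1.trans (Ideal.mul_le.2 fun x hx y hy => ?_)
    obtain ⟨a, ha, b, hb, rfl⟩ := Submodule.mem_sup.1 hx
    obtain ⟨c, hc, d, hd, rfl⟩ := Submodule.mem_sup.1 hy
    have h2 : (a + b) * (c + d) = a * c + (b * (c + d) + a * d) := by ring
    rw [h2]
    refine Submodule.add_mem_sup ?_ (J.add_mem (J.mul_mem_right _ hb) (J.mul_mem_left _ hd))
    rw [pow_succ]
    exact Ideal.mul_mem_mul ha hc

variable {M N : Type u} [AddCommGroup M] [Module R M] [AddCommGroup N] [Module R N]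
  (I J : Ideal R)

variable {I J} in
theorem mem_torsion_iff {x : M} : x ∈ torsion M I J ↔
    ∀ p : PrimeSpectrum R, (∀ r : R, r • x = 0 → r ∈ p.asIdeal) → p ∈ W I J := by
  refine ⟨fun h p hp => h ((mem_support_span_singleton x p).2 hp), fun h p hp => h p ?_⟩
  exact (mem_support_span_singleton x p).1 hp

theorem mem_torsion_of_injective {f : M →ₗ[R] N} (hf : Function.Injective f) {x : M}
    (hx : f x ∈ torsion N I J) : x ∈ torsion M I J := by
  rw [mem_torsion_iff] at hx ⊢
  intro p hp
  refine hx p fun r hr => hp r (hf ?_)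
  rw [map_smul, hr, map_zero]

theorem torsion_eq_top_of_surjective {f : M →ₗ[R] N} (hf : Function.Surjective f)
    (hM : torsion M I J = ⊤) : torsion N I J = ⊤ := by
  rw [eq_top_iff]
  intro y _
  obtain ⟨x, rfl⟩ := hf y
  exact map_mem_torsion I J f x (hM ▸ Submodule.mem_top)

theorem torsion_torsion : torsion (torsion M I J) I J = ⊤ := by
  rw [eq_top_iff]
  rintro x -
  exact mem_torsion_of_injective I J (torsion M I J).subtype_injective x.2

/-- For a prime outside `W`, some `s` outside it carries `x` into the torsion and some `t` outside
it kills `s • x`; then `t * s` is outside the prime and kills `x`. -/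
theorem torsion_quotient_torsion : torsion (M ⧸ torsion M I J) I J = ⊥ := by
  rw [eq_bot_iff]
  intro y hy
  obtain ⟨x, rfl⟩ := Submodule.Quotient.mk_surjective _ y
  rw [Submodule.mem_bot, Submodule.Quotient.mk_eq_zero, mem_torsion_iff]
  intro p hp
  by_contra hpW
  refine hpW (mem_torsion_iff.1 hy p fun s hs => ?_)
  rw [← Submodule.Quotient.mk_smul, Submodule.Quotient.mk_eq_zero, mem_torsion_iff] at hs
  by_contra hsp
  refine hpW (hs p fun t ht => ?_)
  rw [smul_smul] at ht
  exact (p.isPrime.mem_or_mem (hp _ ht)).resolve_right hsp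

variable [IsNoetherianRing R]

/-- Every prime containing the annihilator of `x` contains a prime that is the annihilator of a
multiple of `x`. -/
theorem exists_annihilator_smul_le (x : M) (q : PrimeSpectrum R)
    (hq : ∀ r : R, r • x = 0 → r ∈ q.asIdeal) :
    ∃ (p : PrimeSpectrum R) (r : R), p.asIdeal ≤ q.asIdeal ∧
      ∀ t : R, t • r • x = 0 ↔ t ∈ p.asIdeal := by
  have h1 : Module.annihilator R (Submodule.span R {x}) ≤ q.asIdeal := fun r hr =>
    hq r ((Submodule.mem_annihilator_span_singleton x r).1 hr)
  obtain ⟨p, hp, hpq⟩ := Ideal.exists_minimalPrimes_le h1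
  have h2 := Module.associatedPrimes.minimalPrimes_annihilator_subset_associatedPrimes R
    (Submodule.span R {x}) hp
  obtain ⟨hprime, ⟨y, hy⟩, h3⟩ := isAssociatedPrime_iff.1 h2
  obtain ⟨r, rfl⟩ := Submodule.mem_span_singleton.1 hy
  refine ⟨⟨p, hprime⟩, r, hpq, fun t => ?_⟩
  change _ ↔ t ∈ p
  rw [SetLike.ext_iff.1 h3 t, Submodule.mem_colon_singleton, Submodule.mem_bot,
    ← Submodule.coe_eq_zero]
  rfl

/-- Any prime over the annihilator of `x` contains some prime `p = ann(r • x)`. A nonzero multiple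
of `r • x` lying in `T` still has annihilator `p`, so `p ∈ W`, and `W` is closed upwards. -/
theorem torsion_eq_top_of_essential (T : Submodule R M) (hT : T ≤ torsion M I J)
    (hess : ∀ x : M, x ≠ 0 → ∃ r : R, r • x ≠ 0 ∧ r • x ∈ T) : torsion M I J = ⊤ := by
  rw [eq_top_iff]
  rintro x -
  rw [mem_torsion_iff]
  intro q hq
  obtain ⟨p, r, hpq, hp⟩ := exists_annihilator_smul_le x q hq
  have hne : r • x ≠ 0 := fun h =>
    p.isPrime.ne_top ((Ideal.eq_top_iff_one _).2 ((hp 1).1 (by rw [h, smul_zero])))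
  obtain ⟨s, hs0, hsT⟩ := hess _ hne
  refine mem_W_of_le (mem_torsion_iff.1 (hT hsT) p fun t ht => ?_) hpq
  rw [smul_smul, hp] at ht
  exact (p.isPrime.mem_or_mem ht).resolve_right fun h => hs0 ((hp s).2 h)

omit [IsNoetherianRing R] in
theorem exists_maximal_disjoint (T : Submodule R M) :
    ∃ C : Submodule R M, Disjoint T C ∧ ∀ D, Disjoint T D → C ≤ D → D ≤ C := by
  obtain ⟨C, -, hC⟩ := zorn_le_nonempty₀ {C : Submodule R M | Disjoint T C}
    (fun c hc hchain y hy => by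
    refine ⟨sSup c, ?_, fun z hz => le_sSup hz⟩
    have hne : c.Nonempty := ⟨y, hy⟩
    refine Submodule.disjoint_def.2 fun x hxT hx => ?_
    rw [Submodule.mem_sSup_of_directed hne hchain.directedOn] at hx
    obtain ⟨D, hD, hxD⟩ := hx
    exact Submodule.disjoint_def.1 (hc hD) x hxT hxD) ⊥ disjoint_bot_right
  exact ⟨C, hC.1, fun D hD hCD => hC.2 hD hCD⟩

/-- `Γ(M)` is a retract of `M`. For `C` maximal disjoint from `Γ(M)`, the embedding `Γ(M) → M/C` is
essential, so `M/C` is torsion; hence an extension `M/C → M` of the inclusion of `Γ(M)` takes values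
in `Γ(M)`. -/
theorem injective_torsion [hM : Module.Injective R M] : Module.Injective R (torsion M I J) := by
  obtain ⟨C, hTC, hmax⟩ := exists_maximal_disjoint (torsion M I J)
  let i : torsion M I J →ₗ[R] M ⧸ C := C.mkQ ∘ₗ (torsion M I J).subtype
  have hi : Function.Injective i := by
    rw [← LinearMap.ker_eq_bot, eq_bot_iff]
    intro x hx
    have : (x : M) ∈ C := (Submodule.Quotient.mk_eq_zero C).1 hx
    exact Subtype.ext (Submodule.disjoint_def.1 hTC x x.2 this)
  obtain ⟨g, hg⟩ := hM.out i hi (torsion M I J).subtype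
  have htop : torsion (M ⧸ C) I J = ⊤ := by
    refine torsion_eq_top_of_essential I J (LinearMap.range i) ?_ ?_
    · rintro _ ⟨x, rfl⟩
      exact map_mem_torsion I J C.mkQ x x.2
    · intro y hy
      obtain ⟨x, rfl⟩ := Submodule.Quotient.mk_surjective _ y
      have hx : x ∉ C := fun h => hy ((Submodule.Quotient.mk_eq_zero C).2 h)
      have hnd : ¬ Disjoint (torsion M I J) (C ⊔ Submodule.span R {x}) := fun h =>
        hx (hmax _ h le_sup_left (Submodule.mem_sup_right (Submodule.mem_span_singleton_self x)))
      rw [Submodule.disjoint_def] at hnd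
      push Not at hnd
      obtain ⟨t, htT, ht, ht0⟩ := hnd
      obtain ⟨c, hc, z, hz, rfl⟩ := Submodule.mem_sup.1 ht
      obtain ⟨r, rfl⟩ := Submodule.mem_span_singleton.1 hz
      have h1 : i ⟨_, htT⟩ = r • Submodule.Quotient.mk x := by
        change Submodule.Quotient.mk (c + r • x) = _
        rw [Submodule.Quotient.mk_add, (Submodule.Quotient.mk_eq_zero C).2 hc, zero_add,
          Submodule.Quotient.mk_smul]
      refine ⟨r, ?_, ⟨⟨_, htT⟩, h1⟩⟩
      rw [← h1]
      intro h0
      exact ht0 (congrArg Subtype.val (hi (h0.trans (map_zero i).symm)))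
  let ρ : M →ₗ[R] torsion M I J := (g.codRestrict _ fun y =>
    map_mem_torsion I J g y (htop ▸ Submodule.mem_top)) ∘ₗ C.mkQ
  have hρ (x : torsion M I J) : ρ x = x := Subtype.ext (hg x)
  refine ⟨fun X Y _ _ _ _ f hf h => ?_⟩
  obtain ⟨k, hk⟩ := hM.out f hf ((torsion M I J).subtype ∘ₗ h)
  exact ⟨ρ ∘ₗ k, fun x => by rw [LinearMap.comp_apply, hk x]; exact hρ (h x)⟩

end Torsion

/-! ### Acyclicity of torsion modules -/

section Cohomology

variable {R : Type u} [CommRing R] (I J : Ideal R)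

instance : (torsionFunctor I J).Linear R where
  map_smul _ _ := rfl

/-- Left exactness identifies `lc I J 0` with `Γ`, as `epi_lc_zero_map` requires. -/
instance : PreservesFiniteLimits (torsionFunctor I J) := by
  rw [Functor.preservesFiniteLimits_iff_forall_exact_map_and_mono]
  intro S hS
  have hinj := hS.moduleCat_injective_f
  constructor
  · rw [ShortComplex.moduleCat_exact_iff]
    rintro ⟨x, hx⟩ h0
    obtain ⟨y, rfl⟩ := (ShortComplex.moduleCat_exact_iff S).1 hS.exact x (congrArg Subtype.val h0)
    exact ⟨⟨y, mem_torsion_of_injective I J (f := S.f.hom) hinj hx⟩, rfl⟩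
  · rw [ModuleCat.mono_iff_injective]
    intro x y hxy
    exact Subtype.ext (hinj (congrArg Subtype.val hxy))

theorem shortExact_moduleCatMk {A B C : Type u} [AddCommGroup A] [Module R A] [AddCommGroup B]
    [Module R B] [AddCommGroup C] [Module R C] {f : A →ₗ[R] B} {g : B →ₗ[R] C}
    (hf : Function.Injective f) (hg : Function.Surjective g) (hfg : Function.Exact f g) :
    (ShortComplex.moduleCatMk f g hfg.linearMap_comp_eq_zero).ShortExact where
  exact := by
    rw [ShortComplex.moduleCat_exact_iff]
    exact fun x hx => (hfg x).1 hx
  mono_f := (ModuleCat.mono_iff_injective _).2 hf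
  epi_g := (ModuleCat.epi_iff_surjective _).2 hg

theorem epi_lc_zero_map {X Y : ModuleCat.{u} R} (f : X ⟶ Y) [Epi f]
    (hX : torsion X I J = ⊤) : Epi ((lc I J 0).map f) := by
  have h1 : Epi ((torsionFunctor I J).map f) := by
    rw [ModuleCat.epi_iff_surjective]
    rintro ⟨y, hy⟩
    obtain ⟨x, rfl⟩ := (ModuleCat.epi_iff_surjective f).1 inferInstance y
    exact ⟨⟨x, hX ▸ Submodule.mem_top⟩, rfl⟩
  have h2 := (torsionFunctor I J).toRightDerivedZero.naturality f
  have h3 : Epi ((torsionFunctor I J).toRightDerivedZero.app X ≫ (lc I J 0).map f) := by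
    unfold lc
    rw [← h2]
    infer_instance
  exact epi_of_epi ((torsionFunctor I J).toRightDerivedZero.app X) _

/-- Dimension shifting: a torsion `X` embeds in `Γ(E)` with `E` injective, and `Γ(E)` is both
injective and torsion, so the cokernel is torsion too. -/
theorem isZero_lc_succ_of_torsion_eq_top [IsNoetherianRing R] (i : ℕ) (X : ModuleCat.{u} R)
    (hX : torsion X I J = ⊤) : IsZero ((lc I J (i + 1)).obj X) := by
  induction i using Nat.strong_induction_on generalizing X with | _ i ih => ?_
  obtain ⟨⟨E, hE, ι, hι⟩⟩ := EnoughInjectives.presentation X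
  have hinj := (ModuleCat.mono_iff_injective ι).1 hι
  have hE' : Module.Injective R E := Module.injective_module_of_injective_object R E
  have := injective_torsion (M := E) I J
  have hT : Injective (ModuleCat.of R (torsion E I J)) :=
    Module.injective_object_of_injective_module R (torsion E I J)
  let f : X →ₗ[R] torsion E I J := ι.hom.codRestrict _ fun x =>
    map_mem_torsion I J ι.hom x (hX ▸ Submodule.mem_top)
  have hf : Function.Injective f := fun x y h => hinj (congrArg Subtype.val h)
  have hS := shortExact_moduleCatMk hf (Submodule.mkQ_surjective (LinearMap.range f))
    (LinearMap.exact_map_mkQ_range f)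
  set S := ShortComplex.moduleCatMk f (LinearMap.range f).mkQ _
  have hE0 (i : ℕ) : IsZero ((lc I J (i + 1)).obj S.X₂) :=
    (torsionFunctor I J).isZero_rightDerived_obj_injective_succ i
      (ModuleCat.of R (torsion E I J))
  obtain ⟨δ, w₀, w₁, w₂, -, -, hex⟩ := exists_rightDerived_connecting (torsionFunctor I J) hS i
  refine hex.isZero_X₂ ?_ ((hE0 i).eq_of_tgt _ _)
  -- Degree-zero cohomology of the cokernel need not vanish; there the connecting map is zero
  -- because it is preceded by an epimorphism.
  cases i with
  | zero =>
    have : Epi S.g := hS.epi_g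
    have := epi_lc_zero_map I J S.g (torsion_torsion (M := E) I J)
    exact zero_of_epi_comp ((lc I J 0).map S.g) w₁
  | succ i =>
    exact (ih i (Nat.lt_succ_self i) S.X₃ (torsion_eq_top_of_surjective I J
      (Submodule.mkQ_surjective _) (torsion_torsion (M := E) I J))).eq_of_src _ _

/-- Passing to the quotient by the torsion submodule does not change cohomology in positive
degrees. -/
theorem bijective_lc_map_mkQ [IsNoetherianRing R] (i : ℕ) (M : Type u) [AddCommGroup M]
    [Module R M] :
    Function.Bijective ((lc I J (i + 1)).map (ModuleCat.ofHom (torsion M I J).mkQ)).hom := by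
  have hS := shortExact_moduleCatMk (torsion M I J).subtype_injective
    (torsion M I J).mkQ_surjective (LinearMap.exact_subtype_mkQ (torsion M I J))
  obtain ⟨δ, w₀, w₁, w₂, hex, hex', -⟩ :=
    exists_rightDerived_connecting (torsionFunctor I J) hS (i + 1)
  have h0 (i : ℕ) : IsZero ((lc I J (i + 1)).obj (ModuleCat.of R (torsion M I J))) :=
    isZero_lc_succ_of_torsion_eq_top I J i (ModuleCat.of R (torsion M I J))
      (torsion_torsion (M := M) I J)
  constructor
  · refine (ModuleCat.mono_iff_injective _).1 ?_
    refine hex.mono_g ((h0 i).eq_of_src _ _)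
  · exact (ModuleCat.epi_iff_surjective _).1 (hex'.epi_f ((h0 (i + 1)).eq_of_tgt _ _))

end Cohomology
-- Serre classes and quotients `A/𝔞A`
section Serre

variable {R : Type u} [CommRing R] (S : ObjectProperty (ModuleCat.{u} R)) [S.IsSerreClass]
  {A B C : Type u} [AddCommGroup A] [Module R A] [AddCommGroup B] [Module R B]
  [AddCommGroup C] [Module R C]

theorem serre_of_injective {f : A →ₗ[R] B} (hf : Function.Injective f)
    (hB : S (ModuleCat.of R B)) : S (ModuleCat.of R A) := by
  have : Mono (ModuleCat.ofHom f) := (ModuleCat.mono_iff_injective _).2 hf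
  exact S.prop_of_mono (ModuleCat.ofHom f) hB

theorem serre_of_surjective {f : A →ₗ[R] B} (hf : Function.Surjective f)
    (hA : S (ModuleCat.of R A)) : S (ModuleCat.of R B) := by
  have : Epi (ModuleCat.ofHom f) := (ModuleCat.epi_iff_surjective _).2 hf
  exact S.prop_of_epi (ModuleCat.ofHom f) hA

theorem serre_of_exact {f : A →ₗ[R] B} {g : B →ₗ[R] C} (hfg : Function.Exact f g)
    (hA : S (ModuleCat.of R A)) (hC : S (ModuleCat.of R C)) : S (ModuleCat.of R B) :=
  S.prop_X₂_of_exact (S := ShortComplex.moduleCatMk f g hfg.linearMap_comp_eq_zero)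
    ((ShortComplex.moduleCat_exact_iff _).2 fun x hx => (hfg x).1 hx) hA hC

variable (A) in
theorem serre_of_subsingleton [Subsingleton A] : S (ModuleCat.of R A) :=
  S.prop_of_isZero (ModuleCat.isZero_of_subsingleton _)

theorem serre_range_of_ker_le {φ : A →ₗ[R] B} {ψ : A →ₗ[R] C}
    (h : LinearMap.ker ψ ≤ LinearMap.ker φ) (hC : S (ModuleCat.of R C)) :
    S (ModuleCat.of R (LinearMap.range φ)) := by
  have h1 : S (ModuleCat.of R (A ⧸ LinearMap.ker ψ)) :=
    serre_of_injective S (f := (LinearMap.ker ψ).liftQ ψ le_rfl)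
      (LinearMap.ker_eq_bot.1 (Submodule.ker_liftQ_eq_bot' _ ψ rfl)) hC
  refine serre_of_surjective S (f := (LinearMap.ker ψ).liftQ φ.rangeRestrict
    (h.trans (LinearMap.ker_rangeRestrict φ).ge)) ?_ h1
  rintro ⟨_, x, rfl⟩
  exact ⟨Submodule.Quotient.mk x, rfl⟩

theorem serre_pi_fin (hC : S (ModuleCat.of R C)) (k : ℕ) : S (ModuleCat.of R (Fin k → C)) := by
  induction k with
  | zero => exact serre_of_subsingleton S _
  | succ k ih =>
    let f : C →ₗ[R] (Fin (k + 1) → C) := LinearMap.single R (fun _ => C) 0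
    let g : (Fin (k + 1) → C) →ₗ[R] (Fin k → C) := LinearMap.funLeft R C Fin.succ
    refine serre_of_exact S (f := f) (g := g) (fun x => ⟨fun hx => ⟨x 0, ?_⟩, ?_⟩) hC ih
    · funext i
      refine Fin.cases ?_ (fun i => ?_) i
      · simp [f]
      · have : x i.succ = 0 := congrFun hx i
        simp [f, this]
    · rintro ⟨c, rfl⟩
      funext i
      simp [f, g, LinearMap.funLeft]

theorem exists_eq_sum_of_mem_span_range_smul_top {k : ℕ} (r : Fin k → R) {x : B}
    (hx : x ∈ Ideal.span (Set.range r) • (⊤ : Submodule R B)) :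
    ∃ b : Fin k → B, x = ∑ i, r i • b i := by
  induction hx using Submodule.smul_induction_on' with
  | smul s hs y _ =>
    obtain ⟨c, rfl⟩ := Ideal.mem_span_range_iff_exists_fun.1 hs
    exact ⟨fun i => c i • y, by simp only [Finset.sum_smul, smul_smul, mul_comm]⟩
  | add x _ y _ hx hy =>
    obtain ⟨b, rfl⟩ := hx
    obtain ⟨c, rfl⟩ := hy
    exact ⟨b + c, by simp [Finset.sum_add_distrib]⟩

/-- If `B/f(A)` and `B/𝔞B` belong to a Serre class and the kernel of `f` is contained in `𝔞A`,
then `A/𝔞A` belongs to the Serre class. -/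
theorem serre_quotient_smul_top {𝔞 : Ideal R} (h𝔞 : 𝔞.FG) (f : A →ₗ[R] B)
    (hker : LinearMap.ker f ≤ 𝔞 • (⊤ : Submodule R A))
    (hcoker : S (ModuleCat.of R (B ⧸ LinearMap.range f)))
    (hB : S (ModuleCat.of R (B ⧸ 𝔞 • (⊤ : Submodule R B)))) :
    S (ModuleCat.of R (A ⧸ 𝔞 • (⊤ : Submodule R A))) := by
  have hle : 𝔞 • (⊤ : Submodule R A) ≤ (𝔞 • (⊤ : Submodule R B)).comap f := by
    rw [← Submodule.map_le_iff_le_comap, Submodule.map_smul'']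
    exact Submodule.smul_mono le_rfl le_top
  let π : (A ⧸ 𝔞 • (⊤ : Submodule R A)) →ₗ[R] B ⧸ 𝔞 • (⊤ : Submodule R B) :=
    Submodule.mapQ _ _ f hle
  refine serre_of_exact S (LinearMap.exact_subtype_ker_map π) ?_ hB
  obtain ⟨k, r, rfl⟩ := Submodule.fg_iff_exists_fin_generating_family.1 h𝔞
  let σ : (Fin k → B) →ₗ[R] B := ∑ i, r i • LinearMap.proj i
  have hσ (b : Fin k → B) : σ b = ∑ i, r i • b i := by simp [σ]
  -- `L` consists of witnesses `f a = ∑ rᵢ bᵢ`, so it maps onto the kernel of `π`. The class of `a`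
  -- depends only on the `bᵢ` modulo `f(A)`, which exhibits that kernel as a subquotient of
  -- `(B/f(A))ᵏ`.
  let L : Submodule R ((Fin k → B) × A) :=
    LinearMap.ker (σ ∘ₗ LinearMap.fst R (Fin k → B) A - f ∘ₗ LinearMap.snd R (Fin k → B) A)
  have hL (z : (Fin k → B) × A) : z ∈ L ↔ σ z.1 = f z.2 := by
    simp [L, sub_eq_zero]
  let φ : L →ₗ[R] A ⧸ Ideal.span (Set.range r) • (⊤ : Submodule R A) :=
    Submodule.mkQ _ ∘ₗ LinearMap.snd R (Fin k → B) A ∘ₗ L.subtype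
  let ψ : L →ₗ[R] (Fin k → B ⧸ LinearMap.range f) :=
    (LinearMap.range f).mkQ.compLeft (Fin k) ∘ₗ LinearMap.fst R (Fin k → B) A ∘ₗ L.subtype
  have hφψ : LinearMap.ker ψ ≤ LinearMap.ker φ := by
    rintro ⟨⟨b, a⟩, hba⟩ hz
    have h1 (i : Fin k) : b i ∈ LinearMap.range f :=
      (Submodule.Quotient.mk_eq_zero _).1 (congrFun hz i)
    choose c hc using h1
    have h2 : σ b = f a := (hL _).1 hba
    -- This is where `hker` enters: `a` differs from an element of `𝔞A` by an element of `ker f ⊆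
    -- 𝔞A`.
    have h3 : a - ∑ i, r i • c i ∈ LinearMap.ker f := by
      simp [LinearMap.mem_ker, ← h2, hσ, hc]
    have h4 : ∑ i, r i • c i ∈ Ideal.span (Set.range r) • (⊤ : Submodule R A) :=
      Submodule.sum_mem _ fun i _ => Submodule.smul_mem_smul
        (Ideal.subset_span (Set.mem_range_self i)) Submodule.mem_top
    refine (Submodule.Quotient.mk_eq_zero _).2 ?_
    have h5 := Submodule.add_mem _ (hker h3) h4
    rwa [sub_add_cancel] at h5
  have hKφ : LinearMap.ker π ≤ LinearMap.range φ := by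
    intro y hy
    obtain ⟨a, rfl⟩ := Submodule.Quotient.mk_surjective _ y
    obtain ⟨b, hb⟩ := exists_eq_sum_of_mem_span_range_smul_top r
      ((Submodule.Quotient.mk_eq_zero _).1 hy)
    exact ⟨⟨(b, a), (hL _).2 ((hσ b).trans hb.symm)⟩, rfl⟩
  exact serre_of_injective S (Submodule.inclusion_injective hKφ)
    (serre_range_of_ker_le S hφψ (serre_pi_fin S hcoker k))

end Serre
-- ZD-modules, regular elements and dimension
section ZD

variable {R : Type u} [CommRing R]

theorem isZD_quotient {M : Type u} [AddCommGroup M] [Module R M] (hM : IsZD R M)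
    (N : Submodule R M) : IsZD R (M ⧸ N) := by
  intro N'
  have hsurj : Function.Surjective (N'.mkQ ∘ₗ N.mkQ) :=
    N'.mkQ_surjective.comp N.mkQ_surjective
  let e := LinearMap.quotKerEquivOfSurjective _ hsurj
  obtain ⟨F, hF, hass, hzd⟩ := hM (LinearMap.ker (N'.mkQ ∘ₗ N.mkQ))
  refine ⟨F, hF, ?_, ?_⟩
  · rwa [← LinearEquiv.AssociatedPrimes.eq e]
  · rw [← hzd]
    ext r
    constructor
    · rintro ⟨m, hm, hr⟩
      exact ⟨e.symm m, by simpa using hm, by rw [← map_smul, hr, map_zero]⟩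
    · rintro ⟨m, hm, hr⟩
      exact ⟨e m, by simpa using hm, by rw [← map_smul, hr, map_zero]⟩

variable [IsNoetherianRing R] {M : Type u} [AddCommGroup M] [Module R M]

/-- An ideal of `W̃(I,J)` contains a nonzerodivisor on every `(I,J)`-torsion-free ZD-module. -/
theorem exists_regular_of_torsion_eq_bot {I J : Ideal R} (hM : IsZD R M)
    (hT : torsion M I J = ⊥) {𝔞 : Ideal R} (h𝔞 : 𝔞 ∈ Wtilde I J) :
    ∃ r ∈ 𝔞, ∀ m : M, r • m = 0 → m = 0 := by
  obtain ⟨F, hF, hass, hzd⟩ := hM ⊥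
  have hmk {m : M} : (Submodule.Quotient.mk m : M ⧸ (⊥ : Submodule R M)) = 0 ↔ m = 0 := by
    rw [Submodule.Quotient.mk_eq_zero, Submodule.mem_bot]
  by_contra! h
  have hsub : (𝔞 : Set R) ⊆ ⋃ p ∈ F, (p : Set R) := by
    rw [← hzd]
    intro r hr
    obtain ⟨m, hrm, hm⟩ := h r hr
    exact ⟨Submodule.Quotient.mk m, fun h0 => hm (hmk.1 h0),
      by rw [← Submodule.Quotient.mk_smul, hrm, Submodule.Quotient.mk_zero]⟩
  -- Prime avoidance puts `𝔞` inside a single associated prime `ann(m)`; then `m` is a nonzero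
  -- torsion element.
  obtain ⟨p, hp, h𝔞p⟩ := (Ideal.subset_union_prime_finite hF (f := id) 0 0
    fun p hp _ _ => (hass hp).isPrime).1 hsub
  obtain ⟨hprime, y, hy⟩ := isAssociatedPrime_iff.1 (hass hp)
  obtain ⟨m, rfl⟩ := Submodule.Quotient.mk_surjective _ y
  have hann (t : R) : t ∈ p ↔ t • m = 0 := by
    rw [SetLike.ext_iff.1 hy t, Submodule.mem_colon_singleton, Submodule.mem_bot,
      ← Submodule.Quotient.mk_smul, hmk]
  have hm : m ∈ torsion M I J := by
    rw [mem_torsion_iff]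
    exact fun q hq => mem_W_of_mem_Wtilde h𝔞 (h𝔞p.trans fun t ht => hq t ((hann t).1 ht))
  rw [hT, Submodule.mem_bot] at hm
  exact hprime.ne_top ((Ideal.eq_top_iff_one p).2 ((hann 1).2 (by rw [hm, smul_zero])))

/-- Every prime in the support of `M/rM` contains `r`, and lies over an associated prime of `M`,
which does not. So every chain in the smaller support can be prolonged downwards; no finiteness of
`M` is needed. -/
theorem supportDim_quotient_range_smul_succ_le {r : R} (hr : ∀ m : M, r • m = 0 → m = 0) :
    Module.supportDim R (M ⧸ LinearMap.range (r • (LinearMap.id : M →ₗ[R] M))) + 1 ≤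
      Module.supportDim R M := by
  set N := LinearMap.range (r • (LinearMap.id : M →ₗ[R] M))
  have le : Module.support R (M ⧸ N) ⊆ Module.support R M :=
    Module.support_subset_of_surjective N.mkQ N.mkQ_surjective
  rcases subsingleton_or_nontrivial (M ⧸ N) with hs | hnt
  · rw [Module.supportDim_eq_bot_of_subsingleton]
    simp
  have : Nonempty (Module.support R (M ⧸ N)) := Module.nonempty_support_of_nontrivial.to_subtype
  have : Nonempty (Module.support R M) := this.map fun p => ⟨p.1, le p.2⟩
  simp only [Module.supportDim, Order.krullDim_eq_iSup_length]
  apply WithBot.coe_le_coe.mpr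
  simp only [ENat.iSup_add, iSup_le_iff]
  intro p
  let q : LTSeries (Module.support R M) :=
    p.map (Set.MapsTo.restrict id (Module.support R (M ⧸ N)) (Module.support R M) le)
      (fun _ _ h ↦ h)
  obtain ⟨y, hy⟩ := Module.mem_support_iff_exists_annihilator.1 p.head.2
  have hrp : r ∈ p.head.1.asIdeal := by
    refine hy ((Submodule.mem_annihilator_span_singleton y r).2 ?_)
    obtain ⟨x, rfl⟩ := Submodule.Quotient.mk_surjective _ y
    rw [← Submodule.Quotient.mk_smul, Submodule.Quotient.mk_eq_zero]
    exact ⟨x, rfl⟩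
  obtain ⟨x, hx⟩ := Module.mem_support_iff_exists_annihilator.1 q.head.2
  obtain ⟨p', s, hp', hs⟩ := exists_annihilator_smul_le x q.head.1 fun t ht =>
    hx ((Submodule.mem_annihilator_span_singleton x t).2 ht)
  have hp'M : p' ∈ Module.support R M := by
    refine Module.mem_support_iff_exists_annihilator.2 ⟨s • x, fun t ht => (hs t).1 ?_⟩
    exact (Submodule.mem_annihilator_span_singleton (s • x) t).1 ht
  have hrp' : r ∉ p'.asIdeal := fun h =>
    p'.isPrime.ne_top ((Ideal.eq_top_iff_one _).2
      ((hs 1).1 (by rw [hr _ ((hs r).2 h), smul_zero])))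
  have hlt : (⟨p', hp'M⟩ : Module.support R M) < q.head := by
    refine lt_of_le_of_ne hp' fun h => hrp' ?_
    rw [show p' = q.head.1 from congrArg Subtype.val h]
    exact hrp
  exact le_of_eq_of_le (by simp; rfl) (le_iSup _ (q.cons ⟨p', hp'M⟩ hlt))

end ZD

/-! ### The induction on dimension -/

section Main

variable {R : Type u} [CommRing R] [IsNoetherianRing R] {I J : Ideal R}
  (S : ObjectProperty (ModuleCat.{u} R)) [S.IsSerreClass]

theorem serre_lc_quotient_smul_top {𝔞 : Ideal R} (h𝔞 : 𝔞 ∈ Wtilde I J) (n k : ℕ) :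
    ∀ (M : Type u) [AddCommGroup M] [Module R M], IsZD R M → Module.supportDim R M < k →
      (∀ i, n + 1 < i → S ((lc I J i).obj (ModuleCat.of R M))) →
      S (ModuleCat.of R ((lc I J (n + 1)).obj (ModuleCat.of R M) ⧸
        (𝔞 • (⊤ : Submodule R ((lc I J (n + 1)).obj (ModuleCat.of R M)))))) := by
  induction k with
  | zero =>
    intro M _ _ _ hdim _
    -- A dimension below `0` is `⊥`, so the base case is the zero module.
    have : Subsingleton M := by
      by_contra h
      rw [not_subsingleton_iff_nontrivial] at h
      have : Nonempty (Module.support R M) := Module.nonempty_support_of_nontrivial.to_subtype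
      exact hdim.not_ge (Order.krullDim_nonneg)
    have h0 : IsZero (ModuleCat.of R M) := ModuleCat.isZero_of_subsingleton _
    have : Injective (ModuleCat.of R M) := h0.injective
    exact serre_of_surjective S (Submodule.mkQ_surjective _) (S.prop_of_isZero
      ((torsionFunctor I J).isZero_rightDerived_obj_injective_succ n (ModuleCat.of R M)))
  | succ k ih =>
    intro M _ _ hZD hdim hS
    let M' := M ⧸ torsion M I J
    have hbij (i : ℕ) := bijective_lc_map_mkQ I J i M
    have hS' (i : ℕ) (hi : n + 1 < i) : S ((lc I J i).obj (ModuleCat.of R M')) := by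
      obtain ⟨i, rfl⟩ := Nat.exists_eq_add_one_of_ne_zero (Nat.ne_zero_of_lt hi)
      exact serre_of_surjective S (hbij i).2 (hS _ hi)
    -- Applied to an isomorphism, this only transports the claim from `M` to `M'`.
    refine serre_quotient_smul_top S (IsNoetherian.noetherian 𝔞)
      ((lc I J (n + 1)).map (ModuleCat.ofHom (torsion M I J).mkQ)).hom ?_ ?_ ?_
    · rw [LinearMap.ker_eq_bot.2 (hbij n).1]
      exact bot_le
    · rw [LinearMap.range_eq_top.2 (hbij n).2]
      exact serre_of_subsingleton S _
    have hZD' : IsZD R M' := isZD_quotient hZD _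
    obtain ⟨r, hr𝔞, hr⟩ :=
      exists_regular_of_torsion_eq_bot hZD' (torsion_quotient_torsion I J) h𝔞
    let f : M' →ₗ[R] M' := r • LinearMap.id
    have hf : Function.Injective f := (injective_iff_map_eq_zero f).2 hr
    let M'' := M' ⧸ LinearMap.range f
    have hse := shortExact_moduleCatMk hf (LinearMap.range f).mkQ_surjective
      (LinearMap.exact_map_mkQ_range f)
    have hmap (i : ℕ) : (lc I J i).map (ModuleCat.ofHom f) =
        r • 𝟙 ((lc I J i).obj (ModuleCat.of R M')) :=
      rightDerived_map_smul_id (torsionFunctor I J) i r (ModuleCat.of R M')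
    have hS'' (i : ℕ) (hi : n + 1 < i) : S ((lc I J i).obj (ModuleCat.of R M'')) := by
      obtain ⟨δ, w₀, w₁, w₂, -, hex, -⟩ := exists_rightDerived_connecting (torsionFunctor I J) hse i
      exact S.prop_X₂_of_exact hex (hS' i hi) (hS' (i + 1) (hi.trans (Nat.lt_succ_self i)))
    have hdim'' : Module.supportDim R M'' < k := by
      by_contra! hk
      have h1 : ((k + 1 : ℕ) : WithBot ℕ∞) ≤ Module.supportDim R M'' + 1 := by
        push_cast
        exact add_le_add_left hk 1
      have h2 : Module.supportDim R M' ≤ Module.supportDim R M :=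
        Module.supportDim_le_of_surjective _ (torsion M I J).mkQ_surjective
      exact (h1.trans ((supportDim_quotient_range_smul_succ_le hr).trans h2)).not_gt hdim
    obtain ⟨δ, w₀, w₁, w₂, hex, hex', -⟩ :=
      exists_rightDerived_connecting (torsionFunctor I J) hse (n + 1)
    let g : ModuleCat.of R M' ⟶ ModuleCat.of R M'' := ModuleCat.ofHom (LinearMap.range f).mkQ
    let δ' : (lc I J (n + 1)).obj (ModuleCat.of R M'') ⟶ (lc I J (n + 2)).obj (ModuleCat.of R M') := δ
    have hex₁ : LinearMap.range ((lc I J (n + 1)).map (ModuleCat.ofHom f)).hom =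
        LinearMap.ker ((lc I J (n + 1)).map g).hom := hex.moduleCat_range_eq_ker
    have hex₂ : LinearMap.range ((lc I J (n + 1)).map g).hom = LinearMap.ker δ'.hom :=
      hex'.moduleCat_range_eq_ker
    refine serre_quotient_smul_top S (IsNoetherian.noetherian 𝔞)
      ((lc I J (n + 1)).map g).hom ?_ ?_ (ih M'' (isZD_quotient hZD' _) hdim'' hS'')
    · refine hex₁.ge.trans ?_
      rintro _ ⟨x, rfl⟩
      have : ((lc I J (n + 1)).map (ModuleCat.ofHom f)).hom x = r • x := by
        rw [hmap]
        rfl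
      exact this ▸ Submodule.smul_mem_smul hr𝔞 Submodule.mem_top
    -- By exactness the connecting map embeds the cokernel in the next cohomology of `M'`.
    · refine serre_of_injective S (f := (LinearMap.range ((lc I J (n + 1)).map g).hom).liftQ
        δ'.hom hex₂.le) ?_ (hS' (n + 2) (Nat.lt_succ_self _))
      exact LinearMap.ker_eq_bot.1 (Submodule.ker_liftQ_eq_bot _ _ _ hex₂.ge)

end Main

end PairLC

theorem theorem4p4 {R : Type u} [CommRing R] [IsNoetherianRing R] (I J : Ideal R)
    (S : CategoryTheory.ObjectProperty (ModuleCat.{u} R)) [S.IsSerreClass]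
    (M : ModuleCat.{u} R) (hM : PairLC.IsZD R M) (hdim : Module.supportDim R M ≠ ⊤)
    (n : ℕ) (hn : 1 ≤ n) (hS : ∀ i : ℕ, n < i → S ((PairLC.lc I J i).obj M)) :
    ∀ 𝔞 ∈ PairLC.Wtilde I J, ∀ i : ℕ, n ≤ i → ∀ j : ℕ,
      S (ModuleCat.of R ((PairLC.lc I J i).obj M ⧸
        (𝔞 ^ j • (⊤ : Submodule R ((PairLC.lc I J i).obj M))))) := by
  intro 𝔞 h𝔞 i hi j
  rcases hi.lt_or_eq with hlt | rfl
  · exact PairLC.serre_of_surjective S (Submodule.mkQ_surjective _) (hS i hlt)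
  · obtain ⟨m, rfl⟩ := Nat.exists_eq_add_one_of_ne_zero (Nat.ne_zero_of_lt hn)
    obtain ⟨k, hk⟩ : ∃ k : ℕ, Module.supportDim R M < k := by
      generalize Module.supportDim R M = d at hdim
      induction d with
      -- `hdim` excludes only `⊤`; the value `⊥` is the zero module.
      | bot => exact ⟨0, WithBot.bot_lt_coe _⟩
      | coe d =>
        have hd : d ≠ ⊤ := fun h => hdim (by rw [h]; rfl)
        lift d to ℕ using hd
        exact ⟨d + 1, by exact_mod_cast Nat.lt_succ_self d⟩
    exact PairLC.serre_lc_quotient_smul_top S (PairLC.pow_mem_Wtilde h𝔞 j) m k M hM hk hS
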